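/- For $t\in\mathbb{C}\setminus\{0\}$ let $f_t(z)=-\frac t4\,\frac{(z^2-2)^2}{z^2-1}$, and let $\mathcal W_1$ be the set of all $t\in\mathbb{C}\setminus\{0\}$ such that $f_t$ has a finite (super)attracting fixed point, i.e. a point $z\in\mathbb{C}\setminus\{\pm1\}$ with $f_t(z)=z$ and $|f_t'(z)|<1$. For every $t\in\mathcal W_1$ this fixed point $z_t$ is unique; let $\lambda_t=f_t'(z_t)$ be its multiplier, and put $\lambda_0=0$. Then $\mathcal W_1\cup\{0\}$ is a simply connected domain in $\mathbb{C}$ (open, connected and simply connected), and the multiplier map $t\mapsto\lambda_t$ is a proper holomorphic map of $\mathcal W_1\cup\{0\}$ onto the open unit disc $\mathbb{D}$ of degree four (every $w\in\mathbb{D}$ is taken exactly four times, counted with multiplicity). Moreover $\lambda_t\sim t^4$ as $t\to0$, and the multiplier map has no critical point in $\mathcal W_1\cup\{0\}$ other than $t=0$, i.e. $\frac{d}{dt}\lambda_t\neq0$ for every $t\in\mathcal W_1$. -/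

import Mathlib

open Set Filter Topology Asymptotics

namespace JangSteinmetz

/-- The rational map `f_t(z) = -(t/4) (z^2-2)^2 / (z^2-1)`, at finite points `z` that are not
poles (i.e. `z^2 ≠ 1`). -/
noncomputable def ratMap (t z : ℂ) : ℂ := -(t / 4) * ((z ^ 2 - 2) ^ 2 / (z ^ 2 - 1))

/-- `z` is a finite (super)attracting fixed point of `f_t`: a point of `ℂ`, not a pole, fixed by
`f_t`, whose multiplier `f_t'(z)` has modulus less than one. -/
def IsAttractingFixedPoint (t z : ℂ) : Prop :=
  z ^ 2 ≠ 1 ∧ ratMap t z = z ∧ ‖deriv (ratMap t) z‖ < 1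

/-- The set `W_1` of parameters `t ∈ ℂ \ {0}` for which `f_t` has a finite (super)attracting
fixed point. -/
def W1 : Set ℂ := {t | t ≠ 0 ∧ ∃ z, IsAttractingFixedPoint t z}

open Classical in
/-- The multiplier map `t ↦ λ_t = f_t'(z_t)` on `W_1`, where `z_t` is the finite attracting fixed
point of `f_t` (that it is unique is asserted in the theorem), extended to `t = 0` by the
value `0`. -/
noncomputable def multiplier (t : ℂ) : ℂ :=
  if h : t ∈ W1 then deriv (ratMap t) h.2.choose else 0

/-- `f : U → V` is a proper holomorphic map of mapping degree `d`: it is holomorphic on `U`, the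
map `U → V` is proper, and every value in `V` is taken exactly `d` times in `U`, counted with
multiplicity. -/
def IsProperHolomorphicOfDegree (f : ℂ → ℂ) (U V : Set ℂ) (d : ℕ) : Prop :=
  DifferentiableOn ℂ f U ∧
  (∃ h : MapsTo f U V, IsProperMap h.restrict) ∧
  ∀ w ∈ V, {t ∈ U | f t = w}.Finite ∧
    ∑ᶠ t ∈ {t ∈ U | f t = w}, analyticOrderAt (fun s => f s - w) t = d

end JangSteinmetz

namespace JangSteinmetz

/-! A nonzero parameter is determined by its fixed point: `f_t z = z` forces `t = fixedParam z`,
with multiplier `2z⁴/((z²-1)(z²-2))`. Setting this equal to `v²` gives a quadratic in `z²` of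
discriminant `v²(v²+16)`, with roots `4v/(3v+s)` and `4v/(3v-s)`, where `s = √(v²+16)`. Putting `v =
w²` also removes the square root in `z`. So the attracting fixed points are parametrized by `w` in
the unit disc, with multiplier `w⁴` and parameter `t = G(w)`, `G = uniformization`.

Everything reduces to the univalence of `G` (`injOn_uniformization`). It follows from `Re (w G'/G) >
0` (`starlike_re_pos`): in the coordinate `ζ = log w` the function `log G` has derivative of
positive real part on a half-plane. Then `G` maps the disc biholomorphically onto `W1 ∪ {0}`, the
multiplier map is `w ↦ w⁴` read through `G`, and `G'(0) = 1` gives `λ_t ∼ t⁴`. -/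

/-! ### The square root of `v² + 16` on the unit disc. -/

/-- The principal branch of `√(v ^ 2 + 16)` on the unit disc. -/
noncomputable def rootTerm (v : ℂ) : ℂ := Complex.exp (Complex.log (v ^ 2 + 16) / 2)

theorem re_sq_add_sixteen {v : ℂ} (hv : ‖v‖ < 1) : 15 < (v ^ 2 + 16).re := by
  have h1 : ‖v ^ 2‖ < 1 := by
    rw [norm_pow]; exact pow_lt_one₀ (norm_nonneg v) hv two_ne_zero
  have h2 := (abs_le.1 (Complex.abs_re_le_norm (v ^ 2))).1
  simp only [Complex.add_re, Complex.re_ofNat]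
  linarith

theorem rootTerm_sq {v : ℂ} (hv : ‖v‖ < 1) : rootTerm v ^ 2 = v ^ 2 + 16 := by
  have h0 : v ^ 2 + 16 ≠ 0 := fun h => by
    have := re_sq_add_sixteen hv
    rw [h, Complex.zero_re] at this
    linarith
  rw [rootTerm, ← Complex.exp_nat_mul]
  convert Complex.exp_log h0 using 2
  push_cast
  ring

/-- Evenness lets `v ↦ -v` exchange the two roots of the quadratic for `z²`. -/
theorem rootTerm_neg (v : ℂ) : rootTerm (-v) = rootTerm v := by simp [rootTerm]

theorem rootTerm_zero : rootTerm 0 = 4 := by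
  have h : (16 : ℂ) = ((4 ^ 2 : ℝ) : ℂ) := by norm_num
  have : Complex.log 16 / 2 = ((Real.log 4 : ℝ) : ℂ) := by
    rw [h, ← Complex.ofReal_log (by norm_num), Real.log_pow]
    push_cast
    ring
  rw [rootTerm, zero_pow two_ne_zero, zero_add, this, ← Complex.ofReal_exp,
    Real.exp_log (by norm_num)]
  norm_num

theorem rootTerm_re_pos {v : ℂ} (hv : ‖v‖ < 1) : 0 < (rootTerm v).re := by
  have h15 := re_sq_add_sixteen hv
  have hpos : 0 < (v ^ 2 + 16).re := by linarith
  have harg := abs_lt.1 (Complex.abs_arg_lt_pi_div_two_iff.2 (Or.inl hpos))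
  rw [rootTerm, Complex.exp_re]
  refine mul_pos (Real.exp_pos _) (Real.cos_pos_of_mem_Ioo ?_)
  have : (Complex.log (v ^ 2 + 16) / 2).im = (v ^ 2 + 16).arg / 2 := by
    rw [show (2 : ℂ) = ((2 : ℝ) : ℂ) by norm_num, Complex.div_ofReal_im, Complex.log_im]
  rw [this]
  constructor <;> linarith [harg.1, harg.2, Real.pi_pos]

theorem fifteen_lt_rootTerm_re_sq {v : ℂ} (hv : ‖v‖ < 1) : 15 < (rootTerm v).re ^ 2 := by
  have h := congrArg Complex.re (rootTerm_sq hv)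
  have h15 := re_sq_add_sixteen hv
  rw [← h, pow_two, Complex.mul_re] at h15
  nlinarith [sq_nonneg (rootTerm v).im]

theorem three_lt_rootTerm_re {v : ℂ} (hv : ‖v‖ < 1) : 3 < (rootTerm v).re := by
  nlinarith [fifteen_lt_rootTerm_re_sq hv, rootTerm_re_pos hv]

theorem abs_re_lt_one {v : ℂ} (hv : ‖v‖ < 1) : -1 < v.re ∧ v.re < 1 :=
  abs_lt.1 ((Complex.abs_re_le_norm v).trans_lt hv)

/-- Since `Re s > 3` and `|Re v| < 1`, the quantities `s ± v` and `3v + s` lie in the right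
half-plane: they never vanish, and their principal logarithms are holomorphic. -/
theorem rootTerm_add_re_pos {v : ℂ} (hv : ‖v‖ < 1) : 0 < (rootTerm v + v).re := by
  have := three_lt_rootTerm_re hv
  have := abs_re_lt_one hv
  rw [Complex.add_re]; linarith

theorem rootTerm_sub_re_pos {v : ℂ} (hv : ‖v‖ < 1) : 0 < (rootTerm v - v).re := by
  have := three_lt_rootTerm_re hv
  have := abs_re_lt_one hv
  rw [Complex.sub_re]; linarith

theorem three_mul_add_rootTerm_re_pos {v : ℂ} (hv : ‖v‖ < 1) :
    0 < (3 * v + rootTerm v).re := by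
  have := three_lt_rootTerm_re hv
  have := abs_re_lt_one hv
  simp only [Complex.add_re, Complex.mul_re, Complex.re_ofNat, Complex.im_ofNat, zero_mul,
    sub_zero]
  linarith

theorem hasDerivAt_rootTerm {v : ℂ} (hv : ‖v‖ < 1) :
    HasDerivAt rootTerm (v / rootTerm v) v := by
  have h15 := re_sq_add_sixteen hv
  have hpos : 0 < (v ^ 2 + 16).re := by linarith
  have h := ((((hasDerivAt_pow 2 v).add_const 16).clog (Or.inl hpos)).div_const 2).cexp
  refine h.congr_deriv ?_
  have hs := Complex.ne_zero_of_re_pos (rootTerm_re_pos hv)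
  have hq := Complex.ne_zero_of_re_pos hpos
  change rootTerm v * _ = _
  rw [← rootTerm_sq hv]
  field_simp
  ring

/-! ### The logarithmic derivative and starlikeness. -/

/-- The logarithm of `G w / w` as a function of `v = w ^ 2`, for the uniformization `G` of `W_1`. -/
noncomputable def logFactor (v : ℂ) : ℂ :=
  Complex.log 2 + Complex.log (rootTerm v - v) + Complex.log (3 * v + rootTerm v) / 2
    - 2 * Complex.log (rootTerm v + v)

theorem hasDerivAt_logFactor {v : ℂ} (hv : ‖v‖ < 1) :
    HasDerivAt logFactor
      (-(17 * v + 3 * rootTerm v) / (2 * rootTerm v * (3 * v + rootTerm v))) v := by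
  have hs := hasDerivAt_rootTerm hv
  have h1 := (hs.sub (hasDerivAt_id v)).clog (Or.inl (rootTerm_sub_re_pos hv))
  have h2 := (((hasDerivAt_id v).const_mul 3).add hs).clog
    (Or.inl (three_mul_add_rootTerm_re_pos hv))
  have h3 := (hs.add (hasDerivAt_id v)).clog (Or.inl (rootTerm_add_re_pos hv))
  have h := (((h1.const_add (Complex.log 2)).add (h2.div_const 2)).sub (h3.const_mul 2))
  refine h.congr_deriv ?_
  have n0 := Complex.ne_zero_of_re_pos (rootTerm_re_pos hv)
  have n1 := Complex.ne_zero_of_re_pos (rootTerm_sub_re_pos hv)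
  have n2 := Complex.ne_zero_of_re_pos (three_mul_add_rootTerm_re_pos hv)
  have n3 := Complex.ne_zero_of_re_pos (rootTerm_add_re_pos hv)
  have e1 : v / rootTerm v - 1 = -(rootTerm v - v) / rootTerm v := by field_simp; ring
  have e2 : v / rootTerm v + 1 = (rootTerm v + v) / rootTerm v := by field_simp; ring
  have e3 : 3 * 1 + v / rootTerm v = (3 * rootTerm v + v) / rootTerm v := by field_simp
  simp only [Pi.sub_apply, Pi.add_apply, id, e1, e2, e3]
  generalize hq : 3 * v + rootTerm v = q at n2
  field_simp
  linear_combination (6 : ℂ) * hq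

theorem exp_logFactor {v : ℂ} (hv : ‖v‖ < 1) :
    Complex.exp (logFactor v) = 2 * (rootTerm v - v)
      * Complex.exp (Complex.log (3 * v + rootTerm v) / 2) / (rootTerm v + v) ^ 2 := by
  have n1 := Complex.ne_zero_of_re_pos (rootTerm_sub_re_pos hv)
  have n3 := Complex.ne_zero_of_re_pos (rootTerm_add_re_pos hv)
  have h3 : Complex.exp (2 * Complex.log (rootTerm v + v)) = (rootTerm v + v) ^ 2 := by
    have := Complex.exp_nat_mul (Complex.log (rootTerm v + v)) 2
    rwa [Complex.exp_log n3, Nat.cast_ofNat] at this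
  rw [logFactor, Complex.exp_sub, Complex.exp_add, Complex.exp_add, Complex.exp_log two_ne_zero,
    Complex.exp_log n1, h3]

/-- The logarithmic derivative of `w ↦ w * exp (logFactor (w ^ 2))`, multiplied by `w`. -/
theorem one_add_mul_deriv_logFactor {v : ℂ} (hv : ‖v‖ < 1) :
    1 + 2 * v * (-(17 * v + 3 * rootTerm v) / (2 * rootTerm v * (3 * v + rootTerm v)))
      = 16 * (1 - v ^ 2) / (16 + v ^ 2 + 3 * v * rootTerm v) := by
  have n0 := Complex.ne_zero_of_re_pos (rootTerm_re_pos hv)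
  have n2 := Complex.ne_zero_of_re_pos (three_mul_add_rootTerm_re_pos hv)
  have h := rootTerm_sq hv
  have : 16 + v ^ 2 + 3 * v * rootTerm v = rootTerm v * (3 * v + rootTerm v) := by
    linear_combination -h
  rw [this]
  generalize hq : 3 * v + rootTerm v = q at n2
  field_simp
  linear_combination h - rootTerm v * hq

/-- The starlikeness inequality. -/
theorem starlike_re_pos {v : ℂ} (hv : ‖v‖ < 1) :
    0 < (16 * (1 - v ^ 2) / (16 + v ^ 2 + 3 * v * rootTerm v)).re := by
  have ha := rootTerm_re_pos hv
  have h15 := fifteen_lt_rootTerm_re_sq hv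
  have h := rootTerm_sq hv
  set a := (rootTerm v).re
  set b := (rootTerm v).im
  have hre : a ^ 2 - b ^ 2 = v.re ^ 2 - v.im ^ 2 + 16 := by
    have := congrArg Complex.re h
    simp only [pow_two, Complex.add_re, Complex.mul_re, Complex.re_ofNat] at this
    linear_combination this
  have him : a * b = v.re * v.im := by
    have := congrArg Complex.im h
    simp only [pow_two, Complex.add_im, Complex.mul_im, Complex.im_ofNat] at this
    linear_combination this / 2
  have hR : v.re ^ 2 + v.im ^ 2 < 1 := by
    have := Complex.sq_norm v
    rw [Complex.normSq_apply] at this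
    nlinarith [norm_nonneg v]
  set x := v.re
  set y := v.im
  -- This is the real part of `(1 - v²)` times the conjugate of the denominator. With `R = x² + y²`,
  -- the bounds `x a ≥ -5` and `y b ≤ y²` leave at least `1 - R² + (27 - 3R) y²`, which is positive
  -- as `R < 1`.
  have key : 0 < 16 - (x ^ 2 + y ^ 2) ^ 2 - 15 * (x ^ 2 - y ^ 2)
      + 3 * ((1 - (x ^ 2 + y ^ 2)) * x * a - (1 + (x ^ 2 + y ^ 2)) * y * b) := by
    have hb : b ^ 2 ≤ 1 := by
      have h1 : a ^ 2 * b ^ 2 = x ^ 2 * y ^ 2 := by rw [← mul_pow, him, mul_pow]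
      have h2 : x ^ 2 * y ^ 2 ≤ 1 :=
        mul_le_one₀ (by nlinarith [sq_nonneg y]) (sq_nonneg y) (by nlinarith [sq_nonneg x])
      nlinarith [sq_nonneg b]
    have ha3 : 3 < a := three_lt_rootTerm_re hv
    have ha5 : a < 5 := by nlinarith [sq_nonneg x, sq_nonneg y]
    have hx : |x| ≤ 1 := (Complex.abs_re_le_norm v).trans hv.le
    have hxa : -5 ≤ x * a := by nlinarith [abs_le.1 hx]
    have hyb : y * b ≤ y ^ 2 := by
      have h1 : a * (y * b) = x * y ^ 2 := by linear_combination y * him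
      have h2 : x * y ^ 2 ≤ a * y ^ 2 := by nlinarith [abs_le.1 hx, sq_nonneg y]
      exact le_of_mul_le_mul_left (h1.trans_le h2) ha
    have h1 := mul_le_mul_of_nonneg_left hxa (sub_nonneg.2 hR.le)
    have h2 := mul_le_mul_of_nonneg_left hyb
      (show 0 ≤ 1 + (x ^ 2 + y ^ 2) by positivity)
    nlinarith [sq_nonneg y, mul_nonneg (sub_nonneg.2 hR.le) (sq_nonneg y),
      mul_nonneg (sub_nonneg.2 hR.le) (add_nonneg (sq_nonneg x) (sq_nonneg y))]
  have hnum : 0 < ((1 - v ^ 2) * (starRingEnd ℂ) (16 + v ^ 2 + 3 * v * rootTerm v)).re := by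
    refine lt_of_lt_of_eq key ?_
    simp only [pow_two, Complex.mul_re, Complex.mul_im, Complex.sub_re, Complex.sub_im,
      Complex.add_re, Complex.add_im, Complex.conj_re, Complex.conj_im, Complex.re_ofNat,
      Complex.im_ofNat, Complex.one_re, Complex.one_im]
    simp only [← show (rootTerm v).re = a from rfl, ← show (rootTerm v).im = b from rfl,
      ← show v.re = x from rfl, ← show v.im = y from rfl]
    ring
  -- The denominator cannot vanish, since its conjugate is a factor of a number with positive real
  -- part.
  have hd : 0 < Complex.normSq (16 + v ^ 2 + 3 * v * rootTerm v) := by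
    refine Complex.normSq_pos.2 fun h0 => ?_
    rw [h0, map_zero, mul_zero, Complex.zero_re] at hnum
    exact lt_irrefl _ hnum
  have : (16 * (1 - v ^ 2) / (16 + v ^ 2 + 3 * v * rootTerm v)).re
      = 16 * ((1 - v ^ 2) * (starRingEnd ℂ) (16 + v ^ 2 + 3 * v * rootTerm v)).re
        / Complex.normSq (16 + v ^ 2 + 3 * v * rootTerm v) := by
    rw [div_eq_mul_inv, Complex.inv_def, ← mul_assoc, Complex.re_mul_ofReal, mul_assoc,
      show (16 : ℂ) = ((16 : ℝ) : ℂ) by norm_num, Complex.re_ofReal_mul, div_eq_mul_inv]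
  rw [this]
  positivity

/-! ### Univalence of the uniformization. -/

/-- The **Noshiro–Warschawski theorem**: a function whose derivative has positive real part on a
convex set is injective there. -/
theorem injOn_of_re_deriv_pos {S : Set ℂ} (hS : Convex ℝ S) {f f' : ℂ → ℂ}
    (hf : ∀ z ∈ S, HasDerivAt f (f' z) z) (hpos : ∀ z ∈ S, 0 < (f' z).re) : InjOn f S := by
  intro a ha b hb hab
  by_contra hne
  have hd : b - a ≠ 0 := sub_ne_zero.2 (Ne.symm hne)
  have hmem : ∀ t ∈ Icc (0 : ℝ) 1, a + t * (b - a) ∈ S := fun t ht => by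
    -- Along the segment from `a` to `b`, the real part of `f / (b - a)` has derivative `Re f' > 0`,
    -- so it is strictly increasing.
    simpa using hS.add_smul_sub_mem ha hb ht
  have hder : ∀ t ∈ Icc (0 : ℝ) 1, HasDerivAt (fun t : ℝ => (f (a + t * (b - a)) / (b - a)).re)
      (f' (a + t * (b - a))).re t := fun t ht => by
    have h1 : HasDerivAt (fun x : ℂ => a + x * (b - a)) (b - a) (t : ℂ) := by
      simpa using ((hasDerivAt_id (t : ℂ)).mul_const (b - a)).const_add a
    have h2 := ((hf _ (hmem t ht)).comp (t : ℂ) h1).div_const (b - a)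
    rw [mul_div_cancel_right₀ _ hd] at h2
    exact h2.real_of_complex
  have hmono : StrictMonoOn (fun t : ℝ => (f (a + t * (b - a)) / (b - a)).re) (Icc 0 1) := by
    refine strictMonoOn_of_deriv_pos (convex_Icc 0 1)
      (fun t ht => (hder t ht).continuousAt.continuousWithinAt) fun t ht => ?_
    rw [(hder t (interior_subset ht)).deriv]
    exact hpos _ (hmem t (interior_subset ht))
  have := hmono (left_mem_Icc.2 zero_le_one) (right_mem_Icc.2 zero_le_one) zero_lt_one
  simp [hab] at this

/-- The uniformization of `W_1 ∪ {0}` by the unit disc. -/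
noncomputable def uniformization (w : ℂ) : ℂ := w * Complex.exp (logFactor (w ^ 2))

theorem norm_sq_lt_one {w : ℂ} (hw : ‖w‖ < 1) : ‖w ^ 2‖ < 1 := by
  rw [norm_pow]; exact pow_lt_one₀ (norm_nonneg w) hw two_ne_zero

theorem hasDerivAt_uniformization {w : ℂ} (hw : ‖w‖ < 1) :
    HasDerivAt uniformization (Complex.exp (logFactor (w ^ 2)) *
      (16 * (1 - (w ^ 2) ^ 2) / (16 + (w ^ 2) ^ 2 + 3 * w ^ 2 * rootTerm (w ^ 2)))) w := by
  have hv := norm_sq_lt_one hw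
  have h := (hasDerivAt_id w).mul
    (((hasDerivAt_logFactor hv).comp w (hasDerivAt_pow 2 w)).cexp)
  refine h.congr_deriv ?_
  rw [← one_add_mul_deriv_logFactor hv]
  simp only [id, Function.comp_apply]
  push_cast
  ring

theorem deriv_uniformization_ne_zero {w : ℂ} (hw : ‖w‖ < 1) : deriv uniformization w ≠ 0 := by
  rw [(hasDerivAt_uniformization hw).deriv]
  exact mul_ne_zero (Complex.exp_ne_zero _)
    (Complex.ne_zero_of_re_pos (starlike_re_pos (norm_sq_lt_one hw)))

theorem uniformization_zero : uniformization 0 = 0 := zero_mul _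

theorem deriv_uniformization_zero : deriv uniformization 0 = 1 := by
  have h0 : ‖(0 : ℂ)‖ < 1 := by simp
  have hre : Complex.exp (Complex.log 4 / 2) = 2 := by
    have : Complex.log 4 / 2 = ((Real.log 2 : ℝ) : ℂ) := by
      rw [show (4 : ℂ) = ((2 ^ 2 : ℝ) : ℂ) by norm_num, ← Complex.ofReal_log (by norm_num),
        Real.log_pow]
      push_cast
      ring
    rw [this, ← Complex.ofReal_exp, Real.exp_log two_pos]
    norm_num
  rw [(hasDerivAt_uniformization h0).deriv, zero_pow two_ne_zero, exp_logFactor h0,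
    rootTerm_zero, mul_zero, zero_add, hre]
  norm_num

theorem uniformization_eq_zero_iff {w : ℂ} : uniformization w = 0 ↔ w = 0 := by
  simp [uniformization, Complex.exp_ne_zero]

theorem injOn_uniformization : InjOn uniformization (Metric.ball 0 1) := by
  have hexp : ∀ ζ : ℂ, ζ.re < 0 → ‖Complex.exp ζ‖ < 1 := fun ζ hζ => by
    rw [Complex.norm_exp]; exact Real.exp_lt_one_iff.mpr hζ
  have hconv : Convex ℝ {ζ : ℂ | ζ.re < 0} := convex_halfSpace_re_lt 0
  -- This function is a logarithm of `uniformization (exp ζ)`. Passing to `ζ` turns the punctured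
  -- disc into a convex half-plane.
  have hinj := injOn_of_re_deriv_pos hconv
    (f := fun ζ => ζ + logFactor (Complex.exp ζ ^ 2))
    (f' := fun ζ => 16 * (1 - (Complex.exp ζ ^ 2) ^ 2)
      / (16 + (Complex.exp ζ ^ 2) ^ 2 + 3 * Complex.exp ζ ^ 2 * rootTerm (Complex.exp ζ ^ 2)))
    (fun ζ hζ => by
      have hv := norm_sq_lt_one (hexp ζ hζ)
      have h := (hasDerivAt_id ζ).add
        ((hasDerivAt_logFactor hv).comp ζ ((Complex.hasDerivAt_exp ζ).pow 2))
      refine h.congr_deriv ?_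
      rw [← one_add_mul_deriv_logFactor hv]
      push_cast
      ring)
    (fun ζ hζ => starlike_re_pos (norm_sq_lt_one (hexp ζ hζ)))
  intro w₁ h₁ w₂ h₂ h
  rw [mem_ball_zero_iff] at h₁ h₂
  rcases eq_or_ne w₁ 0 with rfl | n₁
  · exact (uniformization_eq_zero_iff.1 (h.symm.trans uniformization_zero)).symm
  have n₂ : w₂ ≠ 0 := fun h0 => n₁ (uniformization_eq_zero_iff.1
    (h.trans (uniformization_eq_zero_iff.2 h0)))
  have hlog : ∀ w : ℂ, w ≠ 0 → ‖w‖ < 1 → (Complex.log w).re < 0 := fun w hw hw1 => by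
    rw [Complex.log_re]
    exact Real.log_neg (norm_pos_iff.2 hw) hw1
  have hG : ∀ w : ℂ, w ≠ 0 →
      uniformization w = Complex.exp (Complex.log w + logFactor (w ^ 2)) := fun w hw => by
    rw [Complex.exp_add, Complex.exp_log hw, uniformization]
  rw [hG w₁ n₁, hG w₂ n₂, Complex.exp_eq_exp_iff_exists_int] at h
  obtain ⟨n, hn⟩ := h
  -- The `2πi n` ambiguity is absorbed by shifting `log w₂`: the shift stays in the half-plane and
  -- changes neither `exp` nor the `logFactor` term.
  have he : Complex.exp (Complex.log w₂ + n * (2 * Real.pi * Complex.I)) = w₂ := by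
    rw [Complex.exp_add, Complex.exp_int_mul_two_pi_mul_I, mul_one, Complex.exp_log n₂]
  have hre : (Complex.log w₂ + n * (2 * Real.pi * Complex.I)).re = (Complex.log w₂).re := by
    simp
  have := hinj (hlog w₁ n₁ h₁) (show (Complex.log w₂ + n * (2 * Real.pi * Complex.I)).re < 0 by
    rw [hre]; exact hlog w₂ n₂ h₂) (by
      simp only [Complex.exp_log n₁, he]
      rw [hn]; ring)
  rw [← Complex.exp_log n₁, this, he]

/-! ### Fixed points and their multipliers. -/

/-- The parameter `t` for which `z` is a fixed point of `f_t`. -/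
noncomputable def fixedParam (z : ℂ) : ℂ := -4 * z * (z ^ 2 - 1) / (z ^ 2 - 2) ^ 2

/-- The multiplier of the fixed point `z` of `f_t`, where `t = fixedParam z`. -/
noncomputable def fixedMultiplier (z : ℂ) : ℂ := 2 * z ^ 4 / ((z ^ 2 - 1) * (z ^ 2 - 2))

theorem hasDerivAt_ratMap (t : ℂ) {z : ℂ} (hz : z ^ 2 - 1 ≠ 0) :
    HasDerivAt (ratMap t) (-(t / 4) * (2 * z ^ 3 * (z ^ 2 - 2) / (z ^ 2 - 1) ^ 2)) z := by
  have h := (((((hasDerivAt_pow 2 z).sub_const 2).pow 2).div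
    ((hasDerivAt_pow 2 z).sub_const 1) hz).const_mul (-(t / 4)))
  refine h.congr_deriv ?_
  push_cast
  simp only [Pi.pow_apply]
  field_simp
  ring

theorem ratMap_fixedParam {z : ℂ} (h1 : z ^ 2 - 1 ≠ 0) (h2 : z ^ 2 - 2 ≠ 0) :
    ratMap (fixedParam z) z = z := by
  rw [ratMap, fixedParam]
  field_simp

theorem deriv_ratMap_fixedParam {z : ℂ} (h1 : z ^ 2 - 1 ≠ 0) (h2 : z ^ 2 - 2 ≠ 0) :
    deriv (ratMap (fixedParam z)) z = fixedMultiplier z := by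
  rw [(hasDerivAt_ratMap _ h1).deriv, fixedParam, fixedMultiplier]
  field_simp

theorem isAttractingFixedPoint_iff {t z : ℂ} (ht : t ≠ 0) :
    IsAttractingFixedPoint t z ↔
      z ^ 2 - 1 ≠ 0 ∧ z ^ 2 - 2 ≠ 0 ∧ t = fixedParam z ∧ ‖fixedMultiplier z‖ < 1 := by
  constructor
  · rintro ⟨h1, hfix, hmul⟩
    have h1 := sub_ne_zero.2 h1
    -- The zeros of `f_t` are not fixed: `z² = 2` would give `z = f_t z = 0`.
    have h2 : z ^ 2 - 2 ≠ 0 := fun h2 => by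
      have hz : z = 0 := by rw [← hfix, ratMap, h2]; simp
      rw [hz] at h2
      norm_num at h2
    have h3 : t = fixedParam z := by
      rw [ratMap] at hfix
      rw [fixedParam, eq_div_iff (pow_ne_zero 2 h2)]
      field_simp at hfix
      linear_combination -hfix
    refine ⟨h1, h2, h3, ?_⟩
    rwa [h3, deriv_ratMap_fixedParam h1 h2] at hmul
  · rintro ⟨h1, h2, rfl, h4⟩
    exact ⟨sub_ne_zero.1 h1, ratMap_fixedParam h1 h2, by rwa [deriv_ratMap_fixedParam h1 h2]⟩

/-- The attracting fixed point of `f_t` for `t = uniformization w`. -/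
noncomputable def fixedPoint (w : ℂ) : ℂ :=
  w * (2 * Complex.exp (-(Complex.log (3 * w ^ 2 + rootTerm (w ^ 2)) / 2)))

theorem exp_half_log_sq {q : ℂ} (hq : q ≠ 0) : Complex.exp (Complex.log q / 2) ^ 2 = q := by
  rw [← Complex.exp_nat_mul]
  convert Complex.exp_log hq using 2
  push_cast
  ring

theorem fixedPoint_sq {w : ℂ} (hw : ‖w‖ < 1) :
    fixedPoint w ^ 2 = 4 * w ^ 2 / (3 * w ^ 2 + rootTerm (w ^ 2)) := by
  have n2 := Complex.ne_zero_of_re_pos (three_mul_add_rootTerm_re_pos (norm_sq_lt_one hw))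
  rw [fixedPoint, Complex.exp_neg, mul_pow, mul_pow, inv_pow, exp_half_log_sq n2]
  ring

theorem fixedPoint_sq_sub_one {w : ℂ} (hw : ‖w‖ < 1) :
    fixedPoint w ^ 2 - 1 = -(rootTerm (w ^ 2) - w ^ 2) / (3 * w ^ 2 + rootTerm (w ^ 2)) := by
  have n2 := Complex.ne_zero_of_re_pos (three_mul_add_rootTerm_re_pos (norm_sq_lt_one hw))
  rw [fixedPoint_sq hw, div_sub_one n2]
  ring

theorem fixedPoint_sq_sub_two {w : ℂ} (hw : ‖w‖ < 1) :
    fixedPoint w ^ 2 - 2 = -2 * (rootTerm (w ^ 2) + w ^ 2) / (3 * w ^ 2 + rootTerm (w ^ 2)) := by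
  have n2 := Complex.ne_zero_of_re_pos (three_mul_add_rootTerm_re_pos (norm_sq_lt_one hw))
  rw [fixedPoint_sq hw, eq_div_iff n2, sub_mul, div_mul_cancel₀ _ n2]
  ring

theorem fixedPoint_sq_sub_one_ne_zero {w : ℂ} (hw : ‖w‖ < 1) : fixedPoint w ^ 2 - 1 ≠ 0 := by
  have hv := norm_sq_lt_one hw
  rw [fixedPoint_sq_sub_one hw]
  exact div_ne_zero (neg_ne_zero.2 (Complex.ne_zero_of_re_pos (rootTerm_sub_re_pos hv)))
    (Complex.ne_zero_of_re_pos (three_mul_add_rootTerm_re_pos hv))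

theorem fixedPoint_sq_sub_two_ne_zero {w : ℂ} (hw : ‖w‖ < 1) : fixedPoint w ^ 2 - 2 ≠ 0 := by
  have hv := norm_sq_lt_one hw
  rw [fixedPoint_sq_sub_two hw]
  exact div_ne_zero (mul_ne_zero (by norm_num) (Complex.ne_zero_of_re_pos (rootTerm_add_re_pos hv)))
    (Complex.ne_zero_of_re_pos (three_mul_add_rootTerm_re_pos hv))

theorem fixedParam_fixedPoint {w : ℂ} (hw : ‖w‖ < 1) :
    fixedParam (fixedPoint w) = uniformization w := by
  have hv := norm_sq_lt_one hw
  have n2 := Complex.ne_zero_of_re_pos (three_mul_add_rootTerm_re_pos hv)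
  have n3 := Complex.ne_zero_of_re_pos (rootTerm_add_re_pos hv)
  have hE := exp_half_log_sq n2
  have hE0 := Complex.exp_ne_zero (Complex.log (3 * w ^ 2 + rootTerm (w ^ 2)) / 2)
  rw [fixedParam, fixedPoint_sq_sub_one hw, fixedPoint_sq_sub_two hw, uniformization,
    exp_logFactor hv, fixedPoint, Complex.exp_neg]
  generalize Complex.exp (Complex.log (3 * w ^ 2 + rootTerm (w ^ 2)) / 2) = e at hE hE0
  rw [← hE]
  field_simp
  ring

theorem fixedMultiplier_fixedPoint {w : ℂ} (hw : ‖w‖ < 1) :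
    fixedMultiplier (fixedPoint w) = w ^ 4 := by
  have hv := norm_sq_lt_one hw
  have n1 := Complex.ne_zero_of_re_pos (rootTerm_sub_re_pos hv)
  have n2 := Complex.ne_zero_of_re_pos (three_mul_add_rootTerm_re_pos hv)
  have n3 := Complex.ne_zero_of_re_pos (rootTerm_add_re_pos hv)
  have hs := rootTerm_sq hv
  rw [fixedMultiplier, fixedPoint_sq_sub_one hw, fixedPoint_sq_sub_two hw,
    show fixedPoint w ^ 4 = (fixedPoint w ^ 2) ^ 2 by ring, fixedPoint_sq hw]
  generalize hq : 3 * w ^ 2 + rootTerm (w ^ 2) = q at n2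
  field_simp
  linear_combination -w ^ 4 * hs

theorem exists_fixedPoint_eq {z : ℂ} (h1 : z ^ 2 - 1 ≠ 0) (h2 : z ^ 2 - 2 ≠ 0)
    (h : ‖fixedMultiplier z‖ < 1) : ∃ w : ℂ, ‖w‖ < 1 ∧ fixedPoint w = z := by
  obtain ⟨v, hv⟩ := IsAlgClosed.exists_pow_nat_eq (fixedMultiplier z) two_pos
  have hv1 : ‖v‖ < 1 := by
    rw [← hv, norm_pow] at h
    exact (pow_lt_one_iff_of_nonneg (norm_nonneg v) two_ne_zero).1 h
  have hs := rootTerm_sq hv1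
  have hL : v ^ 2 * ((z ^ 2 - 1) * (z ^ 2 - 2)) = 2 * z ^ 4 := by
    rw [hv, fixedMultiplier, div_mul_cancel₀ _ (mul_ne_zero h1 h2)]
  -- The quadratic for `z²`, multiplied by `-8`, splits into factors exchanged by `v ↦ -v`; either
  -- sign of `v` is an admissible square root of the multiplier.
  have hfac : (z ^ 2 * (3 * v + rootTerm v) - 4 * v)
      * (z ^ 2 * (3 * -v + rootTerm v) - 4 * -v) = 0 := by
    linear_combination z ^ 4 * hs - 8 * hL
  have : ∃ v' : ℂ, ‖v'‖ < 1 ∧ z ^ 2 * (3 * v' + rootTerm v') = 4 * v' := by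
    rcases mul_eq_zero.1 hfac with h0 | h0
    · exact ⟨v, hv1, sub_eq_zero.1 h0⟩
    · exact ⟨-v, by rwa [norm_neg], by rw [rootTerm_neg]; exact sub_eq_zero.1 h0⟩
  obtain ⟨v', hv', hz⟩ := this
  obtain ⟨w, rfl⟩ := IsAlgClosed.exists_pow_nat_eq v' two_pos
  have hw : ‖w‖ < 1 := by
    rw [norm_pow] at hv'
    exact (pow_lt_one_iff_of_nonneg (norm_nonneg w) two_ne_zero).1 hv'
  have hsq : fixedPoint w ^ 2 = z ^ 2 := by
    rw [fixedPoint_sq hw, ← hz,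
      mul_div_cancel_right₀ _ (Complex.ne_zero_of_re_pos (three_mul_add_rootTerm_re_pos hv'))]
  -- Only `z²` is known so far; as `fixedPoint` is odd, the sign is corrected by `w ↦ -w`.
  rcases sq_eq_sq_iff_eq_or_eq_neg.1 hsq with h0 | h0
  · exact ⟨w, hw, h0⟩
  · refine ⟨-w, by rwa [norm_neg], ?_⟩
    rw [← neg_eq_iff_eq_neg.2 h0, fixedPoint, fixedPoint, neg_sq, neg_mul]

theorem isAttractingFixedPoint_uniformization_iff {w z : ℂ} (hw : ‖w‖ < 1) (h0 : w ≠ 0) :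
    IsAttractingFixedPoint (uniformization w) z ↔ z = fixedPoint w := by
  rw [isAttractingFixedPoint_iff (uniformization_eq_zero_iff.not.2 h0)]
  constructor
  · rintro ⟨h1, h2, h3, h4⟩
    obtain ⟨w', hw', rfl⟩ := exists_fixedPoint_eq h1 h2 h4
    rw [fixedParam_fixedPoint hw'] at h3
    rw [injOn_uniformization (mem_ball_zero_iff.2 hw) (mem_ball_zero_iff.2 hw') h3]
  · rintro rfl
    refine ⟨fixedPoint_sq_sub_one_ne_zero hw, fixedPoint_sq_sub_two_ne_zero hw,
      (fixedParam_fixedPoint hw).symm, ?_⟩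
    rw [fixedMultiplier_fixedPoint hw, norm_pow]
    exact pow_lt_one₀ (norm_nonneg w) hw four_ne_zero

/-! ### The parameter set as the image of the disc. -/

theorem mem_W1_iff {t : ℂ} : t ∈ W1 ↔ ∃ w : ℂ, ‖w‖ < 1 ∧ w ≠ 0 ∧ uniformization w = t := by
  constructor
  · rintro ⟨ht, z, hz⟩
    obtain ⟨h1, h2, h3, h4⟩ := (isAttractingFixedPoint_iff ht).1 hz
    obtain ⟨w, hw, rfl⟩ := exists_fixedPoint_eq h1 h2 h4
    rw [fixedParam_fixedPoint hw] at h3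
    exact ⟨w, hw, fun h => ht (h3.trans (uniformization_eq_zero_iff.2 h)), h3.symm⟩
  · rintro ⟨w, hw, h0, rfl⟩
    exact ⟨uniformization_eq_zero_iff.not.2 h0, fixedPoint w,
      (isAttractingFixedPoint_uniformization_iff hw h0).2 rfl⟩

theorem W1_union_zero : W1 ∪ {0} = uniformization '' Metric.ball 0 1 := by
  ext t
  rw [mem_union, mem_W1_iff, mem_singleton_iff]
  constructor
  · rintro (⟨w, hw, -, h⟩ | rfl)
    · exact ⟨w, mem_ball_zero_iff.2 hw, h⟩
    · exact ⟨0, by simp, uniformization_zero⟩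
  · rintro ⟨w, hw, rfl⟩
    rcases eq_or_ne w 0 with rfl | h0
    · exact Or.inr uniformization_zero
    · exact Or.inl ⟨w, mem_ball_zero_iff.1 hw, h0, rfl⟩

theorem existsUnique_isAttractingFixedPoint {t : ℂ} (ht : t ∈ W1) :
    ∃! z : ℂ, IsAttractingFixedPoint t z := by
  obtain ⟨w, hw, h0, rfl⟩ := mem_W1_iff.1 ht
  exact ⟨fixedPoint w, (isAttractingFixedPoint_uniformization_iff hw h0).2 rfl,
    fun z hz => (isAttractingFixedPoint_uniformization_iff hw h0).1 hz⟩

theorem multiplier_uniformization {w : ℂ} (hw : ‖w‖ < 1) :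
    multiplier (uniformization w) = w ^ 4 := by
  rcases eq_or_ne w 0 with rfl | h0
  · have : (0 : ℂ) ∉ W1 := fun h => h.1 rfl
    rw [uniformization_zero, multiplier, dif_neg this, zero_pow four_ne_zero]
  · have ht : uniformization w ∈ W1 := mem_W1_iff.2 ⟨w, hw, h0, rfl⟩
    rw [multiplier, dif_pos ht,
      (isAttractingFixedPoint_uniformization_iff hw h0).1 ht.2.choose_spec,
      ← fixedParam_fixedPoint hw, deriv_ratMap_fixedParam (fixedPoint_sq_sub_one_ne_zero hw)
        (fixedPoint_sq_sub_two_ne_zero hw), fixedMultiplier_fixedPoint hw]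

/-! ### The holomorphic inverse and the topology of the image. -/

theorem analyticAt_uniformization {w : ℂ} (hw : ‖w‖ < 1) : AnalyticAt ℂ uniformization w := by
  refine DifferentiableOn.analyticAt (s := Metric.ball 0 1) (fun x hx =>
    (hasDerivAt_uniformization (mem_ball_zero_iff.1 hx)).differentiableAt.differentiableWithinAt) ?_
  exact Metric.isOpen_ball.mem_nhds (mem_ball_zero_iff.2 hw)

theorem hasStrictDerivAt_uniformization {w : ℂ} (hw : ‖w‖ < 1) :
    HasStrictDerivAt uniformization (deriv uniformization w) w :=
  (analyticAt_uniformization hw).hasStrictDerivAt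

/-- The inverse of the uniformization of `W_1 ∪ {0}`. -/
noncomputable def uniformizationInv : ℂ → ℂ :=
  Function.invFunOn uniformization (Metric.ball 0 1)

theorem uniformizationInv_apply {w : ℂ} (hw : ‖w‖ < 1) :
    uniformizationInv (uniformization w) = w :=
  injOn_uniformization.leftInvOn_invFunOn (mem_ball_zero_iff.2 hw)

theorem ball_mem_nhds {w : ℂ} (hw : ‖w‖ < 1) : Metric.ball (0 : ℂ) 1 ∈ 𝓝 w :=
  Metric.isOpen_ball.mem_nhds (mem_ball_zero_iff.2 hw)

theorem hasStrictDerivAt_uniformizationInv {w : ℂ} (hw : ‖w‖ < 1) :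
    HasStrictDerivAt uniformizationInv (deriv uniformization w)⁻¹ (uniformization w) :=
  (hasStrictDerivAt_uniformization hw).to_local_left_inverse (deriv_uniformization_ne_zero hw)
    (by filter_upwards [ball_mem_nhds hw] with x hx
        exact uniformizationInv_apply (mem_ball_zero_iff.1 hx))

theorem isOpen_image_uniformization : IsOpen (uniformization '' Metric.ball 0 1) := by
  rw [isOpen_iff_mem_nhds]
  rintro _ ⟨w, hw, rfl⟩
  rw [mem_ball_zero_iff] at hw
  rw [← (hasStrictDerivAt_uniformization hw).map_nhds_eq (deriv_uniformization_ne_zero hw)]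
  exact image_mem_map (ball_mem_nhds hw)

theorem continuousOn_uniformization : ContinuousOn uniformization (Metric.ball 0 1) :=
  fun _ hw => (analyticAt_uniformization (mem_ball_zero_iff.1 hw)).continuousAt.continuousWithinAt

theorem isSimplyConnected_image_uniformization :
    IsSimplyConnected (uniformization '' Metric.ball 0 1) := by
  have hinv : ContinuousOn uniformizationInv (uniformization '' Metric.ball 0 1) := by
    rintro _ ⟨w, hw, rfl⟩
    exact (hasStrictDerivAt_uniformizationInv
      (mem_ball_zero_iff.1 hw)).hasDerivAt.continuousAt.continuousWithinAt
  have hmaps : MapsTo uniformizationInv (uniformization '' Metric.ball 0 1)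
      (Metric.ball 0 1) := by
    rintro _ ⟨w, hw, rfl⟩
    rwa [uniformizationInv_apply (mem_ball_zero_iff.1 hw)]
  let e : Metric.ball (0 : ℂ) 1 ≃ₜ uniformization '' Metric.ball 0 1 :=
    { toFun := (mapsTo_image uniformization (Metric.ball 0 1)).restrict
      invFun := hmaps.restrict
      left_inv := fun w => Subtype.ext (uniformizationInv_apply (mem_ball_zero_iff.1 w.2))
      right_inv := by
        rintro ⟨_, w, hw, rfl⟩
        exact Subtype.ext (congrArg uniformization
          (uniformizationInv_apply (mem_ball_zero_iff.1 hw)))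
      continuous_toFun := continuousOn_uniformization.mapsToRestrict _
      continuous_invFun := hinv.mapsToRestrict _ }
  have : ContractibleSpace (Metric.ball (0 : ℂ) 1) :=
    (convex_ball 0 1).contractibleSpace (Metric.nonempty_ball.2 one_pos)
  have := e.symm.contractibleSpace
  exact SimplyConnectedSpace.ofContractible _

/-! ### Derivative, properness and degree of the multiplier map. -/

theorem multiplier_eq_on_nhds {w : ℂ} (hw : ‖w‖ < 1) :
    multiplier =ᶠ[𝓝 (uniformization w)] fun t => uniformizationInv t ^ 4 := by
  filter_upwards [isOpen_image_uniformization.mem_nhds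
    (mem_image_of_mem _ (mem_ball_zero_iff.2 hw))]
  rintro _ ⟨x, hx, rfl⟩
  rw [mem_ball_zero_iff] at hx
  rw [multiplier_uniformization hx, uniformizationInv_apply hx]

theorem hasDerivAt_multiplier {w : ℂ} (hw : ‖w‖ < 1) :
    HasDerivAt multiplier (4 * w ^ 3 * (deriv uniformization w)⁻¹) (uniformization w) := by
  have h := (hasStrictDerivAt_uniformizationInv hw).hasDerivAt.pow 4
  rw [uniformizationInv_apply hw] at h
  exact h.congr_of_eventuallyEq (multiplier_eq_on_nhds hw)

theorem mapsTo_multiplier :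
    MapsTo multiplier (uniformization '' Metric.ball 0 1) (Metric.ball 0 1) := by
  rintro _ ⟨w, hw, rfl⟩
  rw [mem_ball_zero_iff] at hw ⊢
  rw [multiplier_uniformization hw, norm_pow]
  exact pow_lt_one₀ (norm_nonneg w) hw four_ne_zero

theorem norm_lt_one_of_pow_four {w c : ℂ} (h : w ^ 4 = c) (hc : c ∈ Metric.ball (0 : ℂ) 1) :
    ‖w‖ < 1 := by
  rw [← h, mem_ball_zero_iff, norm_pow] at hc
  exact (pow_lt_one_iff_of_nonneg (norm_nonneg w) four_ne_zero).1 hc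

theorem isProperMap_multiplier : IsProperMap mapsTo_multiplier.restrict := by
  rw [isProperMap_iff_isCompact_preimage]
  have hcont : ContinuousOn multiplier (uniformization '' Metric.ball 0 1) := by
    rintro _ ⟨w, hw, rfl⟩
    exact (hasDerivAt_multiplier (mem_ball_zero_iff.1 hw)).continuousAt.continuousWithinAt
  refine ⟨hcont.mapsToRestrict _, fun K hK => ?_⟩
  have hK' : IsCompact ((↑) '' K : Set ℂ) := hK.image continuous_subtype_val
  have hsub : {w : ℂ | w ^ 4 ∈ ((↑) '' K : Set ℂ)} ⊆ Metric.ball 0 1 := by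
    rintro w ⟨c, -, hc⟩
    exact mem_ball_zero_iff.2 (norm_lt_one_of_pow_four rfl (hc ▸ c.2))
  -- The preimage of `K` is the image under `uniformization` of `{w | w⁴ ∈ K}`, which is closed in
  -- `ℂ` and bounded.
  have hS : IsCompact {w : ℂ | w ^ 4 ∈ ((↑) '' K : Set ℂ)} :=
    Metric.isCompact_of_isClosed_isBounded (hK'.isClosed.preimage (continuous_pow 4))
      (Metric.isBounded_ball.subset hsub)
  have himg := hS.image_of_continuousOn (continuousOn_uniformization.mono hsub)
  rw [Subtype.isCompact_iff]
  convert himg using 1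
  ext t
  constructor
  · rintro ⟨⟨_, w, hw, rfl⟩, ht, rfl⟩
    refine ⟨w, ⟨_, ht, ?_⟩, rfl⟩
    exact multiplier_uniformization (mem_ball_zero_iff.1 hw)
  · rintro ⟨w, ⟨c, hc, hcw⟩, rfl⟩
    have hw := hsub (show w ^ 4 ∈ ((↑) '' K : Set ℂ) from ⟨c, hc, hcw⟩)
    refine ⟨⟨_, w, hw, rfl⟩, ?_, rfl⟩
    have : MapsTo.restrict _ _ _ mapsTo_multiplier ⟨uniformization w, w, hw, rfl⟩ = c :=
      Subtype.ext ((multiplier_uniformization (mem_ball_zero_iff.1 hw)).trans hcw.symm)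
    rw [mem_preimage, this]
    exact hc

theorem fiber_multiplier {c : ℂ} (hc : c ∈ Metric.ball (0 : ℂ) 1) :
    {t ∈ uniformization '' Metric.ball 0 1 | multiplier t = c}
      = uniformization '' {w | w ^ 4 = c} := by
  ext t
  constructor
  · rintro ⟨⟨w, hw, rfl⟩, h⟩
    exact ⟨w, (multiplier_uniformization (mem_ball_zero_iff.1 hw)).symm.trans h, rfl⟩
  · rintro ⟨w, hw, rfl⟩
    have hw1 := norm_lt_one_of_pow_four hw hc
    exact ⟨⟨w, mem_ball_zero_iff.2 hw1, rfl⟩, (multiplier_uniformization hw1).trans hw⟩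

/-- Since `G' ≠ 0`, precomposing with `G` is a local change of coordinate and preserves orders of
vanishing. -/
theorem analyticOrderAt_multiplier {w : ℂ} (hw : ‖w‖ < 1) (c : ℂ) :
    analyticOrderAt (fun s => multiplier s - c) (uniformization w)
      = analyticOrderAt (fun x : ℂ => x ^ 4 - c) w := by
  rw [← analyticOrderAt_comp_of_deriv_ne_zero (analyticAt_uniformization hw)
    (deriv_uniformization_ne_zero hw)]
  refine analyticOrderAt_congr ?_
  filter_upwards [ball_mem_nhds hw] with x hx
  simp only [Function.comp_apply, multiplier_uniformization (mem_ball_zero_iff.1 hx)]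

theorem finite_pow_four_eq (c : ℂ) : {w : ℂ | w ^ 4 = c}.Finite := by
  refine (Polynomial.nthRoots 4 c).toFinset.finite_toSet.subset fun w hw => ?_
  simpa [Polynomial.mem_nthRoots] using hw

theorem ncard_pow_four_eq {c : ℂ} (hc : c ≠ 0) : {w : ℂ | w ^ 4 = c}.ncard = 4 := by
  obtain ⟨r, rfl⟩ := IsAlgClosed.exists_pow_nat_eq c (n := 4) (by norm_num)
  have hζ := Complex.isPrimitiveRoot_exp 4 four_ne_zero
  have hset : {w : ℂ | w ^ 4 = r ^ 4} = ((Polynomial.nthRoots 4 (r ^ 4)).toFinset : Set ℂ) := by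
    ext w
    simp [Polynomial.mem_nthRoots]
  rw [hset, Set.ncard_coe_finset, Multiset.toFinset_card_of_nodup (hζ.nthRoots_nodup hc),
    hζ.card_nthRoots, if_pos ⟨r, rfl⟩]

theorem sum_analyticOrderAt_pow_four (c : ℂ) :
    ∑ᶠ w ∈ {w : ℂ | w ^ 4 = c}, analyticOrderAt (fun x : ℂ => x ^ 4 - c) w = 4 := by
  -- For `c = 0` there is one root of order four; otherwise there are four simple roots.
  rcases eq_or_ne c 0 with rfl | hc
  · have hset : {w : ℂ | w ^ 4 = 0} = {0} := by ext w; simp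
    rw [hset, finsum_mem_singleton]
    have h := analyticOrderAt_pow (analyticAt_id (𝕜 := ℂ) (z := 0)) 4
    rw [analyticOrderAt_id] at h
    simpa [Pi.pow_def] using h
  · have h1 : ∀ w ∈ {w : ℂ | w ^ 4 = c}, analyticOrderAt (fun x : ℂ => x ^ 4 - c) w = 1 := by
      rintro w rfl
      have hw : w ≠ 0 := by rintro rfl; simp at hc
      refine AnalyticAt.analyticOrderAt_sub_eq_one_of_deriv_ne_zero
        (f := fun x : ℂ => x ^ 4) (by fun_prop) ?_
      simpa using hw
    rw [finsum_mem_congr rfl h1, finsum_mem_eq_finite_toFinset_sum _ (finite_pow_four_eq c),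
      Finset.sum_const, ← Set.ncard_eq_toFinset_card _ (finite_pow_four_eq c),
      ncard_pow_four_eq hc]
    norm_num

theorem isProperHolomorphicOfDegree_multiplier :
    IsProperHolomorphicOfDegree multiplier (uniformization '' Metric.ball 0 1)
      (Metric.ball 0 1) 4 := by
  refine ⟨?_, ⟨mapsTo_multiplier, isProperMap_multiplier⟩, fun c hc => ?_⟩
  · rintro _ ⟨w, hw, rfl⟩
    exact (hasDerivAt_multiplier
      (mem_ball_zero_iff.1 hw)).differentiableAt.differentiableWithinAt
  · rw [fiber_multiplier hc]
    refine ⟨(finite_pow_four_eq c).image _, ?_⟩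
    have hsub : {w : ℂ | w ^ 4 = c} ⊆ Metric.ball 0 1 := fun w hw =>
      mem_ball_zero_iff.2 (norm_lt_one_of_pow_four hw hc)
    rw [finsum_mem_image (injOn_uniformization.mono hsub), finsum_mem_congr rfl fun w hw =>
      analyticOrderAt_multiplier (mem_ball_zero_iff.1 (hsub hw)) c,
      sum_analyticOrderAt_pow_four]
    rfl

theorem image_multiplier :
    multiplier '' (uniformization '' Metric.ball 0 1) = Metric.ball 0 1 := by
  refine mapsTo_multiplier.image_subset.antisymm fun c hc => ?_
  obtain ⟨w, hw⟩ := IsAlgClosed.exists_pow_nat_eq c (n := 4) (by norm_num)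
  have hw1 := norm_lt_one_of_pow_four hw hc
  exact ⟨_, mem_image_of_mem _ (mem_ball_zero_iff.2 hw1),
    (multiplier_uniformization hw1).trans hw⟩

theorem multiplier_isEquivalent : multiplier ~[𝓝[≠] (0 : ℂ)] fun t => t ^ 4 := by
  have h0 : ‖(0 : ℂ)‖ < 1 := by simp
  have hd := (hasStrictDerivAt_uniformizationInv h0).hasDerivAt
  have hi := uniformizationInv_apply h0
  have he := multiplier_eq_on_nhds h0
  rw [deriv_uniformization_zero, inv_one, uniformization_zero] at hd
  rw [uniformization_zero] at hi he
  -- Having value `0` and derivative `1` at `0` is exactly asymptotic equivalence with the identity.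
  have hequiv : uniformizationInv ~[𝓝 (0 : ℂ)] id := by
    have := hd.isLittleO
    simp only [hi, sub_zero, smul_eq_mul, mul_one] at this
    exact this
  exact ((hequiv.pow 4).congr_left he.symm).mono nhdsWithin_le_nhds

end JangSteinmetz

open JangSteinmetz

theorem theoremT6p1 :
    -- `W_1 ∪ {0}` is a simply connected domain
    IsOpen (JangSteinmetz.W1 ∪ {0}) ∧
    IsConnected (JangSteinmetz.W1 ∪ {0}) ∧
    IsSimplyConnected (JangSteinmetz.W1 ∪ {0}) ∧
    -- the multiplier map is well defined on `W_1`
    (∀ t ∈ JangSteinmetz.W1, ∃! z : ℂ, JangSteinmetz.IsAttractingFixedPoint t z) ∧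
    -- it maps `W_1 ∪ {0}` onto the unit disc, properly and with mapping degree four
    JangSteinmetz.multiplier '' (JangSteinmetz.W1 ∪ {0}) = Metric.ball (0 : ℂ) 1 ∧
    JangSteinmetz.IsProperHolomorphicOfDegree JangSteinmetz.multiplier
      (JangSteinmetz.W1 ∪ {0}) (Metric.ball (0 : ℂ) 1) 4 ∧
    -- `λ_t ∼ t ^ 4` as `t → 0`
    JangSteinmetz.multiplier ~[𝓝[≠] (0 : ℂ)] (fun t : ℂ => t ^ 4) ∧
    -- there are no critical points other than `t = 0`
    (∀ t ∈ JangSteinmetz.W1, deriv JangSteinmetz.multiplier t ≠ 0) := by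
  rw [W1_union_zero]
  refine ⟨isOpen_image_uniformization,
    isSimplyConnected_image_uniformization.isPathConnected.isConnected,
    isSimplyConnected_image_uniformization, fun t ht => existsUnique_isAttractingFixedPoint ht,
    image_multiplier, isProperHolomorphicOfDegree_multiplier, multiplier_isEquivalent,
    fun t ht => ?_⟩
  obtain ⟨w, hw, h0, rfl⟩ := mem_W1_iff.1 ht
  rw [(hasDerivAt_multiplier hw).deriv]
  exact mul_ne_zero (mul_ne_zero (by norm_num) (pow_ne_zero 3 h0))
    (inv_ne_zero (deriv_uniformization_ne_zero hw))
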